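/- A frame is called spatial if it is isomorphic to the frame of open sets of some topological space. For a poset $S$, let $\mathrm{Op}\,S$ be the frame of upsets of $S$, ordered by inclusion. For a frame $L$, let $N(L)$ be the frame of nuclei of $L$ (maps $j\colon L\to L$ with $a\le j(a)$, $j(j(a))= j(a)$ and $j(a\wedge b)=j(a)\wedge j(b)$), ordered pointwise. Let $\mathscr T_2$ be the infinite binary tree, that is, the set of all finite words over $\{0,1\}$ with $s\le t$ iff $s$ is an initial segment of $t$. Theorem 3.10. Let $S$ be a poset. Then $N(\mathrm{Op}\,S)$ is not spatial if and only if $\mathscr T_2$ is isomorphic to a subposet of $S$ (a subset of $S$ with the induced order). -/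

import Mathlib

universe u v

/-- A frame is spatial if it is isomorphic to the frame of open sets of some topological space.
The space may be taken in the universe of the frame: see `IsSpatialFrame.of_orderIso`. -/
def IsSpatialFrame (L : Type u) [Order.Frame L] : Prop :=
  ∃ (X : Type u) (_ : TopologicalSpace X), Nonempty (L ≃o TopologicalSpace.Opens X)

/-- Allowing spaces in other universes does not change the notion of spatiality. -/
theorem IsSpatialFrame.of_orderIso {L : Type u} [Order.Frame L] {X : Type v} [TopologicalSpace X]
    (e : L ≃o TopologicalSpace.Opens X) : IsSpatialFrame L := by
  have hinj : ∀ a b : L, Locale.openOfElementHom L a ≤ Locale.openOfElementHom L b → a ≤ b := by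
    intro a b h
    rw [← e.le_iff_le]
    intro x hx
    let p : FrameHom L Prop :=
      { toFun := fun c => x ∈ e c
        map_inf' := by intro c d; simp
        map_top' := by simp
        map_sSup' := by intro s; simp [e.map_sSup, Prop.exists_iff] }
    exact h (a := p) hx
  let f : L → TopologicalSpace.Opens (Locale.PT L) :=
    fun a => ⟨Locale.openOfElementHom L a, a, rfl⟩
  have hf : ∀ a b, f a ≤ f b ↔ a ≤ b := fun a b =>
    ⟨fun h => hinj a b h, fun h p hp => OrderHomClass.mono p h hp⟩
  have hs : Function.Surjective f := by
    rintro ⟨_, a, rfl⟩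
    exact ⟨a, rfl⟩
  exact ⟨Locale.PT L, inferInstance,
    ⟨RelIso.ofSurjective (OrderEmbedding.ofMapLEIff f hf) hs⟩⟩

/-- `Op S`: the frame of upsets of the poset `S` ordered by inclusion, as the frame of open sets of
the Alexandroff space on `S`. In `Topology.WithUpperSet S` the open sets are exactly the upsets. -/
abbrev UpsetFrame (S : Type u) [PartialOrder S] : Type u :=
  TopologicalSpace.Opens (Topology.WithUpperSet S)

/-- The infinite binary tree: its nodes are the finite binary words. -/
def InfBinaryTree : Type := List Bool

/-- The tree order: `s ≤ t` iff the word `s` is an initial segment of the word `t`. So the root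
(the empty word) is the least node, and the immediate successors of `s` are `s0` and `s1`. -/
instance : PartialOrder InfBinaryTree where
  le s t := List.IsPrefix s t
  le_refl s := List.prefix_refl s
  le_trans _ _ _ h k := List.IsPrefix.trans h k
  le_antisymm _ _ h k := h.eq_of_length_le k.length_le

/-! A nucleus `n` lies below the relative double negation `a ↦ (a ⇨ p) ⇨ p` exactly when it fixes
`p` (`Nucleus.le_relDoubleNeg_iff`). Hence this nucleus is a prime element of `Nucleus L` whenever
`p` is prime in `L`; conversely a prime nucleus `m` sends `⊥` to a prime of `L` fixed by `m`. Since a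
frame is spatial iff its primes separate its elements, spatiality of `Nucleus L` becomes a question
about which primes of `L` are fixed by which nuclei.

In the frame of upsets of `S` the primes are the upsets with nonempty directed complement. The
question is then whether `S` contains a nonempty *branching* set: a subset `E` in which above every
element there are two elements without a common upper bound in `E`.

* Let `k` and `j` be nuclei such that `j` fixes every prime that `k` fixes, and let `V = k V` be an
  upset with `j V ≠ V`. Then `j V \ V` is branching: if the members of `j V \ V` above one of its
  elements `x` formed a directed set, then `↑x ⇨ V` would be a prime fixed by `k` and not by `j`
  (`UpsetFrame.isSpatialFrame_nucleus_of_not_branching`).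
* If `E` is branching and `V` is the complement of its downward closure, then the double negation
  relative to `V` fixes no prime at all, although it is not the top nucleus
  (`UpsetFrame.not_isSpatialFrame_of_branching`).

Finally, the binary tree is branching in any poset containing it, and choosing two incompatible
elements above each member of a branching set builds a copy of the tree, one letter at a time.
-/

/-! ### Spatial frames and prime elements -/

section Frame

variable {L : Type u} [Order.Frame L]

/-- The point of the frame `L` given by a prime element `m`: it lies in the opens `c` with
`¬ c ≤ m`. -/
def InfPrime.toPoint {m : L} (hm : InfPrime m) : Locale.PT L where
  toFun c := ¬ c ≤ m
  map_inf' a b := by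
    refine propext ⟨fun h => ⟨fun ha => h (inf_le_of_left_le ha),
      fun hb => h (inf_le_of_right_le hb)⟩, ?_⟩
    rintro ⟨ha, hb⟩ h
    exact (hm.2 h).elim ha hb
  map_top' := propext ⟨fun _ => trivial,
    fun _ h => hm.1 (isTop_iff_isMax.1 fun _ => le_top.trans h)⟩
  map_sSup' s := by simp [sSup_le_iff, Prop.exists_iff]

theorem IsSpatialFrame.of_infPrime_separating
    (h : ∀ a b : L, (∀ m, InfPrime m → b ≤ m → a ≤ m) → a ≤ b) : IsSpatialFrame L := by
  let f : L → TopologicalSpace.Opens (Locale.PT L) :=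
    fun a => ⟨Locale.openOfElementHom L a, a, rfl⟩
  have hf : ∀ a b, f a ≤ f b ↔ a ≤ b := by
    refine fun a b => ⟨fun hab => h a b fun m hm hbm => ?_, fun hab p hp =>
      OrderHomClass.mono p hab hp⟩
    by_contra ham
    exact hab (show hm.toPoint ∈ f a from ham) hbm
  have hs : Function.Surjective f := by
    rintro ⟨_, a, rfl⟩
    exact ⟨a, rfl⟩
  exact .of_orderIso (RelIso.ofSurjective (OrderEmbedding.ofMapLEIff f hf) hs)

theorem IsSpatialFrame.exists_infPrime_ge (h : IsSpatialFrame L) {k : L} (hk : k ≠ ⊤) :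
    ∃ m, InfPrime m ∧ k ≤ m := by
  obtain ⟨X, _, ⟨e⟩⟩ := h
  obtain ⟨x, hx⟩ : ∃ x, x ∉ e k := by
    by_contra! hall
    exact hk ((map_eq_top_iff e).1 (top_le_iff.1 fun x _ => hall x))
  -- The prime attached to the point `x` is the exterior of `{x}`.
  let m : L := e.symm ⟨(closure {x})ᶜ, isClosed_closure.isOpen_compl⟩
  have hm : ∀ c, c ≤ m ↔ x ∉ e c := by
    intro c
    rw [e.le_symm_apply]
    constructor
    · exact fun h hxc => h hxc (subset_closure rfl)
    · intro h y hy hcl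
      obtain ⟨z, hz, rfl⟩ := mem_closure_iff.1 hcl _ (e c).isOpen hy
      exact h hz
  refine ⟨m, ⟨fun hmax => ?_, fun {b c} hbc => ?_⟩, (hm k).2 hx⟩
  · exact (hm ⊤).1 (hmax le_top) (by simp)
  · simp only [hm, map_inf] at hbc ⊢
    by_contra! hcon
    exact hbc hcon

/-! ### Prime nuclei -/

/-- Double negation relative to `c`: the nucleus `a ↦ (a ⇨ c) ⇨ c`. -/
def Nucleus.relDoubleNeg (c : L) : Nucleus L where
  toFun a := (a ⇨ c) ⇨ c
  map_inf' a b := by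
    refine le_antisymm (le_inf ?_ ?_) ?_
    · exact himp_le_himp_right (himp_le_himp_right inf_le_left)
    · exact himp_le_himp_right (himp_le_himp_right inf_le_right)
    · rw [le_himp_iff]
      set x := ((a ⇨ c) ⇨ c) ⊓ ((b ⇨ c) ⇨ c)
      set y := a ⊓ b ⇨ c
      have h1 : x ⊓ y ⊓ a ≤ b ⇨ c := by
        rw [le_himp_iff, inf_assoc, inf_assoc]
        exact inf_le_right.trans himp_inf_le
      have h2 : x ⊓ y ⊓ a ≤ (b ⇨ c) ⇨ c := (inf_le_left.trans inf_le_left).trans inf_le_right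
      have h3 : x ⊓ y ≤ a ⇨ c := le_himp_iff.2 ((le_inf h2 h1).trans himp_inf_le)
      have h4 : x ⊓ y ≤ (a ⇨ c) ⇨ c := inf_le_left.trans inf_le_left
      exact (le_inf h4 h3).trans himp_inf_le
  idempotent' a := himp_le_himp_right le_himp_himp
  le_apply' a := le_himp_himp

theorem Nucleus.relDoubleNeg_apply (c a : L) : relDoubleNeg c a = (a ⇨ c) ⇨ c := rfl

/-- `relDoubleNeg c` is the largest nucleus fixing `c`. -/
theorem Nucleus.le_relDoubleNeg_iff {n : Nucleus L} {c : L} : n ≤ relDoubleNeg c ↔ n c ≤ c := by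
  constructor
  · intro h
    simpa [relDoubleNeg_apply] using h c
  · intro h a
    rw [relDoubleNeg_apply, le_himp_iff]
    calc n a ⊓ (a ⇨ c) ≤ n a ⊓ n (a ⇨ c) := inf_le_inf_left _ n.le_apply
      _ = n (a ⊓ (a ⇨ c)) := n.map_inf.symm
      _ ≤ n c := n.monotone inf_himp_le
      _ ≤ c := h

theorem Nucleus.infPrime_relDoubleNeg {p : L} (hp : InfPrime p) : InfPrime (relDoubleNeg p) := by
  refine ⟨fun hmax => hp.1 ?_, fun {b c} hbc => ?_⟩
  · have h : (⊤ : Nucleus L) p ≤ p := le_relDoubleNeg_iff.1 (hmax le_top)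
    exact isTop_iff_isMax.1 fun _ => le_top.trans h
  · rw [le_relDoubleNeg_iff] at hbc
    simpa only [le_relDoubleNeg_iff] using hp.2 hbc

/-- The closed nucleus `x ↦ a ⊔ x`. -/
def Nucleus.closed (a : L) : Nucleus L where
  toFun x := a ⊔ x
  map_inf' _ _ := sup_inf_left ..
  idempotent' x := by simp
  le_apply' _ := le_sup_right

theorem Nucleus.closed_le_iff {a : L} {n : Nucleus L} : closed a ≤ n ↔ a ≤ n ⊥ :=
  ⟨fun h => le_sup_left.trans (h ⊥),
    fun h _ => sup_le (h.trans (n.monotone bot_le)) n.le_apply⟩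

theorem Nucleus.infPrime_apply_bot {m : Nucleus L} (hm : InfPrime m) : InfPrime (m ⊥) := by
  refine ⟨fun hmax => hm.1 (isTop_iff_isMax.1 fun n => ?_), fun {b c} hbc => ?_⟩
  · exact fun _ => le_top.trans ((hmax le_top).trans (m.monotone bot_le))
  · simp only [← closed_le_iff] at hbc ⊢
    exact hm.2 (le_trans (fun x => (sup_inf_right b c x).ge) hbc)

/-- For `Nucleus L` to be spatial it suffices that nuclei are separated by the primes of `L` that
they fix. -/
theorem isSpatialFrame_nucleus
    (h : ∀ j k : Nucleus L, (∀ p, InfPrime p → k p ≤ p → j p ≤ p) → j ≤ k) :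
    IsSpatialFrame (Nucleus L) := by
  refine .of_infPrime_separating fun j k hjk => h j k fun p hp hk => ?_
  rw [← Nucleus.le_relDoubleNeg_iff] at hk ⊢
  exact hjk _ (Nucleus.infPrime_relDoubleNeg hp) hk

theorem IsSpatialFrame.exists_infPrime_fixed (h : IsSpatialFrame (Nucleus L)) {k : Nucleus L}
    (hk : k ≠ ⊤) : ∃ p, InfPrime p ∧ k p ≤ p := by
  obtain ⟨m, hm, hkm⟩ := h.exists_infPrime_ge hk
  exact ⟨m ⊥, Nucleus.infPrime_apply_bot hm, (hkm _).trans_eq (m.idempotent ⊥)⟩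

end Frame

/-! ### The frame of upsets -/

/-- A subset `E` of an ordered set is branching if above each of its elements there are two
elements of `E` having no common upper bound in `E`. -/
def IsBranching {P : Type u} [Preorder P] (E : Set P) : Prop :=
  ∀ x ∈ E, ∃ y ∈ E, ∃ z ∈ E, x ≤ y ∧ x ≤ z ∧ ∀ w ∈ E, y ≤ w → ¬ z ≤ w

namespace UpsetFrame

variable {S : Type u} [PartialOrder S]

theorem mem_of_le (U : UpsetFrame S) {x y : Topology.WithUpperSet S} (hxy : x ≤ y) (hx : x ∈ U) :
    y ∈ U :=
  Topology.IsUpperSet.isOpen_iff_isUpperSet.1 U.isOpen hxy hx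

/-- The principal upset of `x`. -/
def principal (x : Topology.WithUpperSet S) : UpsetFrame S :=
  ⟨Set.Ici x, Topology.IsUpperSet.isOpen_iff_isUpperSet.2 (isUpperSet_Ici x)⟩

theorem mem_principal {x y : Topology.WithUpperSet S} : y ∈ principal x ↔ x ≤ y := Iff.rfl

theorem principal_le_iff {x : Topology.WithUpperSet S} {U : UpsetFrame S} :
    principal x ≤ U ↔ x ∈ U :=
  ⟨fun h => h (mem_principal.2 le_rfl), fun h _ hy => U.mem_of_le hy h⟩

theorem mem_himp_iff {U V : UpsetFrame S} {x : Topology.WithUpperSet S} :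
    x ∈ U ⇨ V ↔ ∀ y, x ≤ y → y ∈ U → y ∈ V := by
  rw [← principal_le_iff, le_himp_iff]
  exact ⟨fun h y hxy hy => h ⟨hxy, hy⟩, fun h y hy => h y hy.1 hy.2⟩

/-- An upset is prime iff its complement is nonempty and directed. -/
theorem infPrime_iff {p : UpsetFrame S} :
    InfPrime p ↔ (∃ x, x ∉ p) ∧ ∀ y z, y ∉ p → z ∉ p → ∃ w, w ∉ p ∧ y ≤ w ∧ z ≤ w := by
  constructor
  · intro hp
    refine ⟨?_, fun y z hy hz => ?_⟩
    · by_contra! hall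
      exact hp.1 fun _ _ x _ => hall x
    · by_contra! hcon
      have hle : principal y ⊓ principal z ≤ p := by
        rintro w ⟨hyw, hzw⟩
        by_contra hw
        exact hcon w hw hyw hzw
      simpa [principal_le_iff, hy, hz] using hp.2 hle
  · rintro ⟨⟨x, hx⟩, hdir⟩
    refine ⟨fun hmax => hx (hmax le_top (trivial : x ∈ (⊤ : UpsetFrame S))), fun {b c} hbc => ?_⟩
    by_contra! hcon
    obtain ⟨y, hyb, hy⟩ := Set.not_subset.1 hcon.1
    obtain ⟨z, hzc, hz⟩ := Set.not_subset.1 hcon.2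
    obtain ⟨w, hw, hyw, hzw⟩ := hdir y z hy hz
    exact hw (hbc ⟨b.mem_of_le hyw hyb, c.mem_of_le hzw hzc⟩)

theorem isSpatialFrame_nucleus_of_not_branching
    (h : ∀ E : Set (Topology.WithUpperSet S), E.Nonempty → ¬ IsBranching E) :
    IsSpatialFrame (Nucleus (UpsetFrame S)) := by
  refine isSpatialFrame_nucleus fun j k hjk U => ?_
  by_contra hU
  set V := k U
  have hkV : k V = V := k.idempotent U
  obtain ⟨x₀, hx₀, hx₀V⟩ := Set.not_subset.1 hU
  have hne : ((j V : Set (Topology.WithUpperSet S)) \ V).Nonempty :=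
    ⟨x₀, j.monotone k.le_apply hx₀, hx₀V⟩
  have hnb := h _ hne
  simp only [IsBranching] at hnb
  push Not at hnb
  obtain ⟨x, ⟨hxj, hxV⟩, hdir⟩ := hnb
  have hmem : ∀ y, y ∉ principal x ⇨ V ↔ ∃ y', y ≤ y' ∧ x ≤ y' ∧ y' ∉ V := by
    intro y
    rw [mem_himp_iff]
    push Not
    rfl
  have hprime : InfPrime (principal x ⇨ V) := by
    refine infPrime_iff.2 ⟨⟨x, (hmem x).2 ⟨x, le_rfl, le_rfl, hxV⟩⟩, fun y z hy hz => ?_⟩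
    obtain ⟨y', hyy', hxy', hy'⟩ := (hmem y).1 hy
    obtain ⟨z', hzz', hxz', hz'⟩ := (hmem z).1 hz
    obtain ⟨w, hw, hyw, hzw⟩ := hdir y' ⟨(j V).mem_of_le hxy' hxj, hy'⟩ z'
      ⟨(j V).mem_of_le hxz' hxj, hz'⟩ hxy' hxz'
    exact ⟨w, (hmem w).2 ⟨w, le_rfl, hxy'.trans hyw, hw.2⟩, hyy'.trans hyw, hzz'.trans hzw⟩
  have hfix : k (principal x ⇨ V) ≤ principal x ⇨ V := k.map_himp_le.trans_eq (by rw [hkV])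
  have hxp : x ∈ principal x ⇨ V := hjk _ hprime hfix (j.monotone le_himp hxj)
  exact (hmem x).2 ⟨x, le_rfl, le_rfl, hxV⟩ hxp

theorem not_isSpatialFrame_of_branching {E : Set (Topology.WithUpperSet S)} (hne : E.Nonempty)
    (hE : IsBranching E) : ¬ IsSpatialFrame (Nucleus (UpsetFrame S)) := by
  intro hspatial
  let V : UpsetFrame S := ⟨(lowerClosure E : Set (Topology.WithUpperSet S))ᶜ,
    Topology.IsUpperSet.isOpen_iff_isUpperSet.2 (lowerClosure E).lower.compl⟩
  have hV : ∀ x, x ∉ V ↔ ∃ a ∈ E, x ≤ a := fun x => by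
    change ¬ x ∉ lowerClosure E ↔ _
    rw [not_not, mem_lowerClosure]
  have hkV : Nucleus.relDoubleNeg V V ≤ V := Nucleus.le_relDoubleNeg_iff.1 le_rfl
  have hk : Nucleus.relDoubleNeg V ≠ ⊤ := by
    intro h
    obtain ⟨a, ha⟩ := hne
    rw [h] at hkV
    exact (hV a).2 ⟨a, ha, le_rfl⟩ (hkV trivial)
  obtain ⟨p, hp, hfix⟩ := hspatial.exists_infPrime_fixed hk
  obtain ⟨⟨x₀, hx₀⟩, hdir⟩ := infPrime_iff.1 hp
  have hVp : V ≤ p := (le_himp.trans (Nucleus.relDoubleNeg_apply V p).ge).trans hfix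
  -- As `p ≠ ⊤` equals its double negation, its relative pseudocomplement is not contained in `V`.
  have hnle : ¬ p ⇨ V ≤ V := by
    intro hle
    rw [Nucleus.relDoubleNeg_apply, himp_eq_top_iff.2 hle] at hfix
    exact hx₀ (hfix trivial)
  obtain ⟨x, hx, hxV⟩ := Set.not_subset.1 hnle
  obtain ⟨a, ha, hxa⟩ := (hV x).1 hxV
  have hout : ∀ y ∈ E, a ≤ y → y ∉ p := fun y hy hay hyp =>
    (hV y).2 ⟨y, hy, le_rfl⟩ (mem_himp_iff.1 hx y (hxa.trans hay) hyp)
  obtain ⟨y, hy, z, hz, hay, haz, hyz⟩ := hE a ha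
  obtain ⟨w, hw, hyw, hzw⟩ := hdir y z (hout y hy hay) (hout z hz haz)
  obtain ⟨b, hb, hwb⟩ := (hV w).1 fun h => hw (hVp h)
  exact hyz b hb (hyw.trans hwb) (hzw.trans hwb)

end UpsetFrame

/-! ### Branching sets and the binary tree -/

theorem InfBinaryTree.isBranching_range {P : Type u} [Preorder P] (f : InfBinaryTree ↪o P) :
    IsBranching (Set.range f) := by
  rintro _ ⟨s, rfl⟩
  refine ⟨_, ⟨List.append s [false], rfl⟩, _, ⟨List.append s [true], rfl⟩,
    f.le_iff_le.2 (List.prefix_append s _), f.le_iff_le.2 (List.prefix_append s _), ?_⟩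
  rintro _ ⟨t, rfl⟩ h0 h1
  obtain ⟨u, hu⟩ := f.le_iff_le.1 h0
  obtain ⟨v, hv⟩ := f.le_iff_le.1 h1
  have incompatible : ∀ l u v : List Bool, l ++ [false] ++ u ≠ l ++ [true] ++ v := by simp
  exact incompatible s u v (hu.trans hv.symm)

/-- The word `s` is sent to the endpoint of the walk that starts at a fixed element and follows the
letters of `s`, each letter choosing one of two incompatible successors. -/
theorem IsBranching.exists_orderEmbedding {P : Type u} [PartialOrder P] {E : Set P}
    (hne : E.Nonempty) (hE : IsBranching E) : Nonempty (InfBinaryTree ↪o P) := by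
  have hstep : ∀ x : E, ∃ g : Bool → E, (∀ b, x ≤ g b) ∧
      ∀ b c, b ≠ c → ∀ w : E, g b ≤ w → ¬ g c ≤ w := by
    rintro ⟨x, hx⟩
    obtain ⟨y, hy, z, hz, hxy, hxz, hyz⟩ := hE x hx
    refine ⟨fun b => bif b then ⟨z, hz⟩ else ⟨y, hy⟩, ?_, ?_⟩
    · rintro (_ | _)
      exacts [hxy, hxz]
    · rintro (_ | _) (_ | _) hbc ⟨w, hw⟩ h1 h2
      exacts [hbc rfl, hyz w hw h1 h2, hyz w hw h2 h1, hbc rfl]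
  choose g hg hinc using hstep
  have hle : ∀ (s : List Bool) (x : E), x ≤ s.foldl g x := by
    intro s
    induction s with
    | nil => exact fun x => le_rfl
    | cons b s ih => exact fun x => (hg x b).trans (ih _)
  have hrefl : ∀ (s t : List Bool) (x : E), s.foldl g x ≤ t.foldl g x → s <+: t := by
    intro s
    induction s with
    | nil => exact fun t x _ => List.nil_prefix
    | cons b s ih =>
      rintro (_ | ⟨c, t⟩) x h
      · exact (hinc x b (!b) (by simp) _ ((hle s _).trans (h.trans (hg x _))) le_rfl).elim
      · obtain rfl : b = c := by
          by_contra hbc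
          exact hinc x b c hbc _ ((hle s _).trans h) (hle t _)
        exact List.cons_prefix_cons.2 ⟨rfl, ih t _ h⟩
  have hmono : ∀ (s t : List Bool) (x : E), s <+: t → s.foldl g x ≤ t.foldl g x := by
    rintro s _ x ⟨u, rfl⟩
    rw [List.foldl_append]
    exact hle u _
  obtain ⟨x₀, hx₀⟩ := hne
  exact ⟨OrderEmbedding.ofMapLEIff
    (fun s : InfBinaryTree => ((List.foldl g ⟨x₀, hx₀⟩ s : E) : P)) fun s t =>
      ⟨hrefl s t _, hmono s t _⟩⟩

theorem theorem3p10 (S : Type u) [PartialOrder S] :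
    ¬ IsSpatialFrame (Nucleus (UpsetFrame S)) ↔
      ∃ T : Set S, Nonempty (InfBinaryTree ≃o T) := by
  constructor
  · intro h
    obtain ⟨E, hne, hE⟩ : ∃ E : Set S, E.Nonempty ∧ IsBranching E := by
      by_contra! hcon
      exact h (UpsetFrame.isSpatialFrame_nucleus_of_not_branching hcon)
    obtain ⟨f⟩ := hE.exists_orderEmbedding hne
    exact ⟨Set.range f, ⟨f.orderIso⟩⟩
  · rintro ⟨T, ⟨e⟩⟩
    let f : InfBinaryTree ↪o S := e.toOrderEmbedding.trans (OrderEmbedding.subtype (· ∈ T))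
    exact UpsetFrame.not_isSpatialFrame_of_branching (S := S) (Set.range_nonempty_iff_nonempty.2
      ⟨([] : List Bool)⟩) (InfBinaryTree.isBranching_range f)
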